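/- Let $k\in\{2,3,\dots\}\cup\{\infty\}$, let $\mathcal M$ be an oriented $M$-dimensional manifold of class $C^k$ (Hausdorff and paracompact, without boundary), let $L$ be a positive integer and let $0\le h\le M-1$. A matrix-valued $C^p$ differential $q$-form on $\mathcal M$ is an $L\times L$ matrix $\omega=(\omega^{(ij)})$ of real differential $q$-forms whose coefficients in every $C^k$ chart are of class $C^p$; its value $\omega_P$ at a point $P$, its exterior derivative $d\omega$ and its integral are taken entrywise, and $(\lambda\wedge\mu)^{(ij)}=\sum_{s}\lambda^{(is)}\wedge\mu^{(sj)}$. Let $\gamma$ be a matrix-valued $C^0$ differential $h$-form on $\mathcal M$ that has a continuous distributional exterior derivative $\delta\gamma$, i.e. $\delta\gamma$ is a matrix-valued $C^0$ differential $(h+1)$-form on $\mathcal M$ such that $$\int_{\mathcal M}\gamma\wedge d\varphi=(-1)^{h+1}\int_{\mathcal M}\delta\gamma\wedge\varphi$$ for every compactly supported matrix-valued $C^{k-1}$ differential $(M-h-1)$-form $\varphi$ on $\mathcal M$ (with $k-1=\infty$ if $k=\infty$). Let $\mathcal Z_\gamma:=\{P\in\mathcal M\mid \gamma_P=0\}$.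 Then $(\delta\gamma)_Q=0$ for every $(M+1)$-density point $Q$ of $\mathcal Z_\gamma$, that is, for every $Q\in\mathcal M$ for which there is a $C^1$ chart $(\mathcal W,\Phi)$ of $\mathcal M$ with $Q\in\mathcal W$ and $$\mathcal L^M\bigl(B_r(\Phi(Q))\setminus\Phi(\mathcal Z_\gamma\cap\mathcal W)\bigr)=o(r^{M+1})\qquad(r\to0+),$$ where $\mathcal L^M$ is Lebesgue measure on $\mathbb R^M$ and $B_r(x)$ is the open Euclidean ball of radius $r$ centred at $x$. -/

import Mathlib

open Set Filter Topology MeasureTheory Asymptotics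
open scoped Manifold

noncomputable section

namespace SuperdensityForms

/-- The model space `ℝ^M`, with the Euclidean norm. -/
abbrev E (M : ℕ) : Type := EuclideanSpace ℝ (Fin M)

/-! ### Exterior product of alternating forms on a vector space -/

section Wedge

variable {V : Type*} [AddCommGroup V] [Module ℝ V]

/-- The exterior product `a ∧ b` as an algebraic alternating form. It is the sum over
`(p, q)`-shuffles, i.e. `AlternatingMap.domCoprod` followed by multiplication `ℝ ⊗ ℝ → ℝ`, with the
arguments numbered by `Fin n`, those of `a` first. -/
def wedgeAlg {p q n : ℕ} (hn : p + q = n) (a : V [⋀^Fin p]→ₗ[ℝ] ℝ) (b : V [⋀^Fin q]→ₗ[ℝ] ℝ) :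
    V [⋀^Fin n]→ₗ[ℝ] ℝ :=
  ((LinearMap.mul' ℝ ℝ).compAlternatingMap (a.domCoprod b)).domDomCongr
    (finSumFinEquiv.trans (finCongr hn))

variable [TopologicalSpace V]

theorem continuous_wedgeAlg {p q n : ℕ} (hn : p + q = n)
    (a : V [⋀^Fin p]→L[ℝ] ℝ) (b : V [⋀^Fin q]→L[ℝ] ℝ) :
    Continuous (fun v : Fin n → V => wedgeAlg hn a.toAlternatingMap b.toAlternatingMap v) := by
  unfold wedgeAlg
  simp only [AlternatingMap.domDomCongr_apply, LinearMap.compAlternatingMap_apply,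
    AlternatingMap.domCoprod_apply, _root_.sum_apply, map_sum]
  refine continuous_finsetSum _ fun σ _ => ?_
  induction σ using Quotient.inductionOn' with
  | h σ =>
    simp only [AlternatingMap.domCoprod.summand_mk'', _root_.smul_apply,
      MultilinearMap.domDomCongr_apply, MultilinearMap.domCoprod_apply, map_zsmul_unit,
      LinearMap.mul'_apply]
    refine Continuous.const_smul (Continuous.mul ?_ ?_) _
    · exact a.coe_continuous.comp (continuous_pi fun i => continuous_apply _)
    · exact b.coe_continuous.comp (continuous_pi fun i => continuous_apply _)

/-- The exterior product `a ∧ b` of continuous alternating forms. -/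
def wedge {p q n : ℕ} (hn : p + q = n) (a : V [⋀^Fin p]→L[ℝ] ℝ) (b : V [⋀^Fin q]→L[ℝ] ℝ) :
    V [⋀^Fin n]→L[ℝ] ℝ :=
  { wedgeAlg hn a.toAlternatingMap b.toAlternatingMap with
    cont := continuous_wedgeAlg hn a b }

end Wedge

/-! ### Differential forms on a manifold -/

section Forms

variable (M : ℕ) (X : Type*) [TopologicalSpace X] [ChartedSpace (E M) X]

/-- A (not necessarily regular) differential `h`-form on the `M`-dimensional manifold `X`. -/
abbrev DForm (h : ℕ) : Type _ := ∀ x : X, (TangentSpace (𝓡 M) x) [⋀^Fin h]→L[ℝ] ℝ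

/-- An `L × L` matrix of differential `h`-forms. -/
abbrev MatForm (L h : ℕ) : Type _ := Matrix (Fin L) (Fin L) (DForm M X h)

variable {M X}

/-- The local representation `(e⁻¹)^* ω` of `ω` in the chart `e`; only its values on `e.target`
are meaningful. -/
def localRep {h : ℕ} (e : OpenPartialHomeomorph X (E M)) (ω : DForm M X h) :
    E M → (E M) [⋀^Fin h]→L[ℝ] ℝ :=
  fun y => (ω (e.symm y)).compContinuousLinearMap (mfderiv (𝓡 M) (𝓡 M) e.symm y)

/-- `ω` is a form of class `C^p` on the `C^k` manifold `X`: its local representation in every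
`C^k` chart is of class `C^p`. -/
def IsFormOfClass {h : ℕ} (k p : WithTop ℕ∞) (ω : DForm M X h) : Prop :=
  ∀ e ∈ IsManifold.maximalAtlas (𝓡 M) k X, ContDiffOn ℝ p (localRep e ω) e.target

/-- The support of a differential form. -/
def formSupport {h : ℕ} (ω : DForm M X h) : Set X := closure {x | ω x ≠ 0}

/-- The exterior derivative, computed at each point in the preferred chart at that point. -/
def dForm {h : ℕ} (ω : DForm M X h) : DForm M X (h + 1) :=
  fun x => (extDeriv (localRep (chartAt (E M) x) ω) (chartAt (E M) x x)).compContinuousLinearMap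
    (mfderiv (𝓡 M) (𝓡 M) (chartAt (E M) x) x)

/-- Exterior product of differential forms. -/
def wedgeForm {p q n : ℕ} (hn : p + q = n) (ω : DForm M X p) (η : DForm M X q) : DForm M X n :=
  fun x => wedge hn (ω x) (η x)

namespace MatForm

variable {L : ℕ}

/-- The value of a matrix-valued form at a point, a matrix of alternating forms on the tangent
space. -/
def eval {h : ℕ} (ω : MatForm M X L h) (x : X) :
    Matrix (Fin L) (Fin L) ((TangentSpace (𝓡 M) x) [⋀^Fin h]→L[ℝ] ℝ) :=
  Matrix.of fun i j => ω i j x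

/-- All the entries are of class `C^p`. -/
def IsOfClass {h : ℕ} (k p : WithTop ℕ∞) (ω : MatForm M X L h) : Prop :=
  ∀ i j, IsFormOfClass k p (ω i j)

/-- All the entries have compact support. -/
def HasCompactSupp {h : ℕ} (ω : MatForm M X L h) : Prop :=
  ∀ i j, IsCompact (formSupport (ω i j))

/-- Entrywise exterior derivative. -/
def d {h : ℕ} (ω : MatForm M X L h) : MatForm M X L (h + 1) :=
  Matrix.of fun i j => dForm (ω i j)

/-- Exterior product: `(ω ∧ η)^(ij) = ∑_s ω^(is) ∧ η^(sj)`. -/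
def wedge {p q n : ℕ} (hn : p + q = n) (ω : MatForm M X L p) (η : MatForm M X L q) :
    MatForm M X L n :=
  Matrix.of fun i j => ∑ s, wedgeForm hn (ω i s) (η s j)

/-- The vanishing set of a matrix-valued form. -/
def zeroSet {h : ℕ} (ω : MatForm M X L h) : Set X := {x | ω.eval x = 0}

end MatForm

end Forms

/-! ### Orientation and integration -/

section Integration

/-- An orientation of the `C^k` manifold `X`, given by an oriented atlas: a family of `C^k` charts
covering `X` whose transition maps have positive Jacobian determinant. -/
structure ManifoldOrientation (M : ℕ) (k : WithTop ℕ∞) (X : Type*) [TopologicalSpace X]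
    [ChartedSpace (E M) X] where
  charts : Set (OpenPartialHomeomorph X (E M))
  charts_subset : charts ⊆ IsManifold.maximalAtlas (𝓡 M) k X
  cover : ∀ x : X, ∃ e ∈ charts, x ∈ e.source
  det_pos : ∀ e ∈ charts, ∀ e' ∈ charts, ∀ y ∈ (e.symm.trans e').source,
    0 < (fderiv ℝ (e.symm.trans e') y).det

variable {M : ℕ} {k : WithTop ℕ∞} {X : Type*} [TopologicalSpace X] [ChartedSpace (E M) X]
  [T2Space X] [ParacompactSpace X]

theorem ManifoldOrientation.exists_partitionOfUnity (o : ManifoldOrientation M k X) :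
    ∃ ρ : PartitionOfUnity o.charts X univ, ρ.IsSubordinate fun e => e.1.source :=
  PartitionOfUnity.exists_isSubordinate isClosed_univ _ (fun e => e.1.open_source)
    fun x _ => by
      obtain ⟨e, he, hx⟩ := o.cover x
      exact mem_iUnion.2 ⟨⟨e, he⟩, hx⟩

/-- A partition of unity subordinate to the domains of the oriented charts. -/
def ManifoldOrientation.partition (o : ManifoldOrientation M k X) :
    PartitionOfUnity o.charts X univ :=
  o.exists_partitionOfUnity.choose

/-- The integral over the oriented manifold `X` of a continuous `M`-form with compact support:
`∑_e ∫_{e.target} (e⁻¹)^*(ρ_e ω)`, where `e` runs over the oriented charts, `ρ` is a subordinate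
partition of unity, and `∫ f dx_1 ∧ … ∧ dx_M = ∫ f dx` on `ℝ^M`. As usual, the value does not depend
on the partition of unity. -/
def ManifoldOrientation.integral (o : ManifoldOrientation M k X) (ω : DForm M X M) : ℝ :=
  ∑ᶠ e : o.charts, ∫ y in e.1.target,
    o.partition e (e.1.symm y) * localRep e.1 ω y (fun i => EuclideanSpace.single i (1 : ℝ))

/-- Entrywise integral of a matrix-valued form. -/
def ManifoldOrientation.matIntegral {L : ℕ} (o : ManifoldOrientation M k X)
    (ω : MatForm M X L M) : Matrix (Fin L) (Fin L) ℝ :=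
  Matrix.of fun i j => o.integral (ω i j)

/-- `δγ` is the distributional exterior derivative of the `h`-form `γ` on the oriented `C^k`
manifold `X` of dimension `M ≥ h + 1`: it is continuous, and
`∫ γ ∧ dφ = (-1)^(h+1) ∫ δγ ∧ φ` for all test forms `φ` of degree `p = M - h - 1`.
The test forms are those of class `C^(k-1)` with compact support: `k - 1` is the largest order of
regularity of a form that is preserved by the coordinate changes of a `C^k` manifold
(`k - 1 = ∞` if `k = ∞`). -/
def IsDED {k : ℕ∞} {L h : ℕ} (o : ManifoldOrientation M k X)
    (γ : MatForm M X L h) (δγ : MatForm M X L (h + 1)) : Prop :=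
  δγ.IsOfClass k 0 ∧
  ∀ (p : ℕ) (hp : h + 1 + p = M) (φ : MatForm M X L p),
    φ.IsOfClass k ((k - 1 : ℕ∞) : WithTop ℕ∞) → φ.HasCompactSupp →
    o.matIntegral (MatForm.wedge (show h + (p + 1) = M by omega) γ φ.d) =
      (-1 : ℝ) ^ (h + 1) • o.matIntegral (MatForm.wedge hp δγ φ)

end Integration

/-! ### Superdensity -/

/-- `P` is an `m`-density point of `A ⊆ X`: in some `C^1` chart `e` around `P`,
`ℒ^M(B_r(e P) \ e(A ∩ W)) = o(r^m)` as `r → 0+`, where `W` is the domain of `e`. -/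
def IsDensityPoint {M : ℕ} {X : Type*} [TopologicalSpace X] [ChartedSpace (E M) X]
    (m : ℝ) (A : Set X) (P : X) : Prop :=
  ∃ e ∈ IsManifold.maximalAtlas (𝓡 M) 1 X, P ∈ e.source ∧
    (fun r : ℝ => (volume (Metric.ball (e P) r \ e '' (A ∩ e.source))).toReal)
      =o[𝓝[>] 0] fun r : ℝ => r ^ m

end SuperdensityForms

end

noncomputable section

/-
In an oriented chart around `Q`, test the weak identity with the rescaled forms
`η_r(y) = φ((y - y₀) / r) c`, where `φ` is a bump function of integral one supported in the unit
ball, `c` is a constant form and `y₀` is the image of `Q`. As `dη_r = O(1 / r)` is supported in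
`B_r(y₀)` and `γ` vanishes on its zero set `Z`, the left side is `O(r⁻¹ ℒ^M(B_r(y₀) \ Z)) = o(r^M)`.
The right side is, up to sign, `r^M ((δγ ∧ c)(y₀) + o(1))`. Hence `(δγ ∧ c)(y₀) = 0` for all `c`,
and so `δγ(y₀) = 0`. Superdensity transfers to the oriented chart because `C^1` coordinate changes
are locally bi-Lipschitz.
-/

namespace SuperdensityForms

/-! ### Exterior products -/

section WedgeAlgebra

variable {V W : Type*} [AddCommGroup V] [Module ℝ V] [TopologicalSpace V]
  [AddCommGroup W] [Module ℝ W] [TopologicalSpace W] {p q n : ℕ}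

theorem wedge_apply (hn : p + q = n) (a : V [⋀^Fin p]→L[ℝ] ℝ) (b : V [⋀^Fin q]→L[ℝ] ℝ)
    (v : Fin n → V) :
    wedge hn a b v = ∑ σ : Equiv.Perm.ModSumCongr (Fin p) (Fin q),
      ((Equiv.Perm.sign σ.out : ℤ) : ℝ) *
        (a (fun i => v (Fin.cast hn (finSumFinEquiv (σ.out (Sum.inl i))))) *
          b (fun j => v (Fin.cast hn (finSumFinEquiv (σ.out (Sum.inr j)))))) := by
  change wedgeAlg hn a.toAlternatingMap b.toAlternatingMap v = _
  simp only [wedgeAlg, AlternatingMap.domDomCongr_apply, LinearMap.compAlternatingMap_apply,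
    AlternatingMap.domCoprod_apply, _root_.sum_apply, map_sum]
  refine Finset.sum_congr rfl fun σ _ => ?_
  conv_lhs => rw [← Quotient.out_eq' σ]
  simp only [AlternatingMap.domCoprod.summand_mk'', _root_.smul_apply,
    MultilinearMap.domDomCongr_apply, MultilinearMap.domCoprod_apply, map_zsmul_unit,
    LinearMap.mul'_apply]
  rw [Units.smul_def, zsmul_eq_mul]
  rfl

theorem wedge_compContinuousLinearMap (hn : p + q = n) (a : V [⋀^Fin p]→L[ℝ] ℝ)
    (b : V [⋀^Fin q]→L[ℝ] ℝ) (f : W →L[ℝ] V) :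
    (wedge hn a b).compContinuousLinearMap f =
      wedge hn (a.compContinuousLinearMap f) (b.compContinuousLinearMap f) := by
  ext v
  simp only [ContinuousAlternatingMap.compContinuousLinearMap_apply, wedge_apply]
  rfl

@[simp]
theorem wedge_zero_left (hn : p + q = n) (b : V [⋀^Fin q]→L[ℝ] ℝ) :
    wedge hn (0 : V [⋀^Fin p]→L[ℝ] ℝ) b = 0 := by
  ext v
  simp [wedge_apply]

@[simp]
theorem wedge_zero_right (hn : p + q = n) (a : V [⋀^Fin p]→L[ℝ] ℝ) :
    wedge hn a (0 : V [⋀^Fin q]→L[ℝ] ℝ) = 0 := by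
  ext v
  simp [wedge_apply]

theorem wedge_smul_right (hn : p + q = n) (a : V [⋀^Fin p]→L[ℝ] ℝ) (r : ℝ)
    (b : V [⋀^Fin q]→L[ℝ] ℝ) :
    wedge hn a (r • b) = r • wedge hn a b := by
  ext v
  simp only [wedge_apply, Finset.mul_sum, ContinuousAlternatingMap.smul_apply, smul_eq_mul]
  exact Finset.sum_congr rfl fun σ _ => by ring

/-- Only the identity shuffle contributes to the sum over shuffles defining `a ∧ b`. -/
theorem wedge_apply_append_of_forall_eq_zero (a : V [⋀^Fin p]→L[ℝ] ℝ) (b : V [⋀^Fin q]→L[ℝ] ℝ)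
    (u : Fin p → V) (w : Fin q → V) (hb : ∀ (x : Fin q → V) (i j), x i = u j → b x = 0) :
    wedge rfl a b (Fin.append u w) = a u * b w := by
  have happend : ∀ s : Fin p ⊕ Fin q, Fin.append u w (finSumFinEquiv s) = Sum.elim u w s :=
    fun s => congrFun Fin.append_comp_sumElim s
  change wedgeAlg rfl a.toAlternatingMap b.toAlternatingMap _ = _
  simp only [wedgeAlg, AlternatingMap.domDomCongr_apply, LinearMap.compAlternatingMap_apply,
    AlternatingMap.domCoprod_apply, _root_.sum_apply, map_sum]
  refine (Fintype.sum_eq_single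
    (Quotient.mk'' (1 : Equiv.Perm (Fin p ⊕ Fin q)) : Equiv.Perm.ModSumCongr (Fin p) (Fin q))
    fun σ hσ => ?_).trans ?_
  · induction σ using Quotient.inductionOn' with
    | h σ =>
      obtain ⟨i, j, hij⟩ : ∃ i j, σ (Sum.inr i) = Sum.inl j := by
        by_contra! hcon
        refine hσ (Quotient.sound' ?_)
        rw [QuotientGroup.leftRel_apply, mul_one]
        refine Subgroup.inv_mem _ (Equiv.Perm.mem_sumCongrHom_range_of_perm_mapsTo_inl ?_)
        rw [Equiv.Perm.perm_mapsTo_inl_iff_mapsTo_inr]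
        rintro _ ⟨i, rfl⟩
        rcases hi : σ (Sum.inr i) with j | j
        · exact absurd hi (hcon i j)
        · exact ⟨j, rfl⟩
      have hzero : b (fun i => Sum.elim u w (σ (Sum.inr i))) = 0 :=
        hb _ i j (by simp only [hij, Sum.elim_inl])
      simp [AlternatingMap.domCoprod.summand_mk'', happend, hzero]
  · simp [AlternatingMap.domCoprod.summand_mk'', happend]

/-- The decomposable form `f 0 ∧ … ∧ f (q - 1)`, written as a determinant. These forms detect the
coordinates of an alternating form. -/
def minorForm (f : Fin q → V →L[ℝ] ℝ) : V [⋀^Fin q]→L[ℝ] ℝ :=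
  { (Matrix.detRowAlternating (n := Fin q) (R := ℝ)).compLinearMap
      (LinearMap.pi fun j => (f j).toLinearMap) with
    cont := by
      change Continuous fun v : Fin q → V => Matrix.det (Matrix.of fun i j => f j (v i))
      fun_prop }

theorem minorForm_apply (f : Fin q → V →L[ℝ] ℝ) (v : Fin q → V) :
    minorForm f v = Matrix.det (Matrix.of fun i j => f j (v i)) :=
  rfl

end WedgeAlgebra

section Nondegeneracy

variable {V : Type*} [NormedAddCommGroup V] [NormedSpace ℝ V] {p q n : ℕ}

theorem continuous_wedge_apply (hn : p + q = n) (v : Fin n → V) :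
    Continuous fun c : (V [⋀^Fin p]→L[ℝ] ℝ) × (V [⋀^Fin q]→L[ℝ] ℝ) => wedge hn c.1 c.2 v := by
  simp only [wedge_apply]
  exact continuous_finsetSum _ fun σ _ => continuous_const.mul
    (((continuous_eval_const _).comp continuous_fst).mul
      ((continuous_eval_const _).comp continuous_snd))

theorem exists_injective_append {u : Fin p → Fin (p + q)} (hu : u.Injective) :
    ∃ w : Fin q → Fin (p + q), (Fin.append u w).Injective := by
  have hcard : Fintype.card ((range u)ᶜ : Set (Fin (p + q))) = q := by
    rw [Fintype.card_compl_set, card_range_of_injective hu, Fintype.card_fin, Fintype.card_fin,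
      Nat.add_sub_cancel_left]
  let w : Fin q ≃ ((range u)ᶜ : Set (Fin (p + q))) := (Fintype.equivFinOfCardEq hcard).symm
  refine ⟨fun j => w j, Fin.append_injective_iff.2
    ⟨hu, Subtype.val_injective.comp w.injective, fun i j hij => (w j).2 ⟨i, hij⟩⟩⟩

theorem wedge_minorForm_coord_apply [FiniteDimensional ℝ V] (a : V [⋀^Fin p]→L[ℝ] ℝ)
    (b : Module.Basis (Fin (p + q)) ℝ V) {u : Fin p → Fin (p + q)} {w : Fin q → Fin (p + q)}
    (huw : (Fin.append u w).Injective) :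
    wedge rfl a (minorForm fun j => (b.coord (w j)).toContinuousLinearMap)
      (b ∘ Fin.append u w) = a (b ∘ u) := by
  obtain ⟨-, hw, hdisj⟩ := Fin.append_injective_iff.1 huw
  have hminor : minorForm (fun j => (b.coord (w j)).toContinuousLinearMap) (b ∘ w) = 1 := by
    rw [minorForm_apply, ← Matrix.det_one (n := Fin q)]
    congr 1
    ext i j
    simp [Matrix.one_apply, Finsupp.single_apply, hw.eq_iff]
  have hcomp : b ∘ Fin.append u w = Fin.append (b ∘ u) (b ∘ w) := by
    ext i
    refine Fin.addCases (fun i => ?_) (fun i => ?_) i <;> simp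
  rw [hcomp, wedge_apply_append_of_forall_eq_zero, hminor, mul_one]
  intro x i j hij
  rw [minorForm_apply]
  refine Matrix.det_eq_zero_of_row_eq_zero i fun l => ?_
  simp [hij, hdisj j l]

theorem eq_zero_of_forall_wedge_eq_zero (hn : p + q = n) (b : Module.Basis (Fin n) ℝ V)
    (a : V [⋀^Fin p]→L[ℝ] ℝ)
    (ha : ∀ c : V [⋀^Fin q]→L[ℝ] ℝ, wedge hn a c b = 0) : a = 0 := by
  subst hn
  have := Module.Finite.of_basis b
  refine ContinuousAlternatingMap.toAlternatingMap_injective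
    (Module.Basis.ext_alternating b fun u hu => ?_)
  obtain ⟨w, huw⟩ := exists_injective_append hu
  let c := minorForm fun j => (b.coord (w j)).toContinuousLinearMap
  have hperm := (wedge rfl a c).toAlternatingMap.map_perm b
    (Equiv.ofBijective _ (Finite.injective_iff_bijective.1 huw))
  calc a (b ∘ u) = wedge rfl a c (b ∘ Fin.append u w) :=
        (wedge_minorForm_coord_apply a b huw).symm
    _ = _ := hperm
    _ = 0 := (congrArg _ (ha c)).trans (smul_zero _)

end Nondegeneracy

/-! ### Pullbacks and exterior derivatives on vector spaces -/

section Pullback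

variable {V W : Type*} [NormedAddCommGroup V] [NormedSpace ℝ V]
  [NormedAddCommGroup W] [NormedSpace ℝ W] {n : ℕ}

instance finiteDimensional_continuousMultilinearMap [FiniteDimensional ℝ W] :
    FiniteDimensional ℝ (ContinuousMultilinearMap ℝ (fun _ : Fin n => W) ℝ) :=
  Module.Finite.of_injective (ContinuousMultilinearMap.toMultilinearMapLinear :
      ContinuousMultilinearMap ℝ (fun _ : Fin n => W) ℝ →ₗ[ℝ] _)
    ContinuousMultilinearMap.toMultilinearMap_injective

theorem contDiff_compContinuousLinearMap [FiniteDimensional ℝ W] {r : WithTop ℕ∞} :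
    ContDiff ℝ r fun cA : (V [⋀^Fin n]→L[ℝ] ℝ) × (W →L[ℝ] V) =>
      cA.1.compContinuousLinearMap cA.2 := by
  let ι := ContinuousAlternatingMap.toContinuousMultilinearMapLI
    (𝕜 := ℝ) (E := W) (F := ℝ) (ι := Fin n)
  obtain ⟨g, hg⟩ := ι.toLinearMap.exists_leftInverse_of_injective
    (LinearMap.ker_eq_bot.2 ι.injective)
  have hfactor : (fun cA : (V [⋀^Fin n]→L[ℝ] ℝ) × (W →L[ℝ] V) =>
      cA.1.compContinuousLinearMap cA.2) = fun cA => LinearMap.toContinuousLinearMap g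
        (cA.1.toContinuousMultilinearMap.compContinuousLinearMap fun _ => cA.2) :=
    funext fun cA => (LinearMap.congr_fun hg (cA.1.compContinuousLinearMap cA.2)).symm
  have hmultilinear : ContDiff ℝ r
      (ContinuousMultilinearMap.compContinuousLinearMapContinuousMultilinear ℝ
        (fun _ : Fin n => W) (fun _ : Fin n => V) ℝ) := ContinuousMultilinearMap.contDiff _
  rw [hfactor]
  exact (ContinuousLinearMap.contDiff _).comp
    ((hmultilinear.comp (contDiff_pi.2 fun _ => contDiff_snd)).clm_apply
      ((ContinuousAlternatingMap.toContinuousMultilinearMapLI (𝕜 := ℝ) (E := V) (F := ℝ)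
        (ι := Fin n)).contDiff.comp contDiff_fst))

theorem continuous_extDeriv {ω : V → V [⋀^Fin n]→L[ℝ] ℝ} (hω : ContDiff ℝ 1 ω) :
    Continuous (extDeriv ω) :=
  (ContinuousAlternatingMap.alternatizeUncurryFinCLM ℝ V ℝ).continuous.comp
    (hω.continuous_fderiv one_ne_zero)

theorem extDeriv_zero : extDeriv (0 : V → V [⋀^Fin n]→L[ℝ] ℝ) = 0 := by
  ext x v
  simp [extDeriv, ContinuousAlternatingMap.alternatizeUncurryFin_apply]

theorem support_extDeriv_subset (ω : V → V [⋀^Fin n]→L[ℝ] ℝ) :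
    Function.support (extDeriv ω) ⊆ tsupport ω := by
  refine Function.support_subset_iff'.2 fun x hx => ?_
  rw [(notMem_tsupport_iff_eventuallyEq.1 hx).extDeriv_eq, extDeriv_zero, Pi.zero_apply]

theorem extDeriv_comp_smul_sub (ω : V → V [⋀^Fin n]→L[ℝ] ℝ) (r : ℝ) (x₀ x : V) :
    extDeriv (fun y => ω (r • (y - x₀))) x = r • extDeriv ω (r • (x - x₀)) := by
  have hfderiv : fderiv ℝ (fun y => ω (r • (y - x₀))) x = r • fderiv ℝ ω (r • (x - x₀)) := by
    rw [fderiv_comp_sub (f := fun z => ω (r • z)), fderiv_comp_smul]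
  rw [extDeriv, hfderiv, ContinuousAlternatingMap.alternatizeUncurryFin_smul, extDeriv]

end Pullback

/-! ### Forms in charts -/

section Charts

variable {M : ℕ} {X : Type*} [TopologicalSpace X] [ChartedSpace (E M) X]
  {e e' : OpenPartialHomeomorph X (E M)} {k : WithTop ℕ∞} {h : ℕ}

theorem mdifferentiable_of_mem_maximalAtlas (hk : k ≠ 0)
    (he : e ∈ IsManifold.maximalAtlas (𝓡 M) k X) : e.MDifferentiable (𝓡 M) (𝓡 M) :=
  ⟨(contMDiffOn_of_mem_maximalAtlas he).mdifferentiableOn hk,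
    (contMDiffOn_symm_of_mem_maximalAtlas he).mdifferentiableOn hk⟩

theorem contDiffAt_coordChange (he : e ∈ IsManifold.maximalAtlas (𝓡 M) k X)
    (he' : e' ∈ IsManifold.maximalAtlas (𝓡 M) k X) {y : E M} (hy : y ∈ (e.symm.trans e').source) :
    ContDiffAt ℝ k (e.symm.trans e') y :=
  contMDiffAt_iff_contDiffAt.1 <|
    (contMDiffAt_of_mem_maximalAtlas he' hy.2).comp y (contMDiffAt_symm_of_mem_maximalAtlas he hy.1)

theorem fderiv_coordChange (he : e.MDifferentiable (𝓡 M) (𝓡 M))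
    (he' : e'.MDifferentiable (𝓡 M) (𝓡 M)) {y : E M} (hy : y ∈ (e.symm.trans e').source) :
    fderiv ℝ (e.symm.trans e') y =
      (mfderiv (𝓡 M) (𝓡 M) e' (e.symm y)).comp (mfderiv (𝓡 M) (𝓡 M) e.symm y) := by
  rw [← mfderiv_eq_fderiv]
  exact mfderiv_comp y (he'.mdifferentiableAt hy.2) (he.mdifferentiableAt_symm hy.1)

theorem localRep_wedgeForm {p q n : ℕ} (hn : p + q = n) (ω : DForm M X p) (η : DForm M X q)
    (y : E M) :
    localRep e (wedgeForm hn ω η) y = wedge hn (localRep e ω y) (localRep e η y) :=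
  wedge_compContinuousLinearMap hn _ _ _

theorem localRep_eq_zero {ω : DForm M X h} {y : E M} (hω : ω (e.symm y) = 0) :
    localRep e ω y = 0 := by
  rw [localRep, hω]
  rfl

theorem localRep_comp_mfderiv (he : e.MDifferentiable (𝓡 M) (𝓡 M)) (ω : DForm M X h) {x : X}
    (hx : x ∈ e.source) :
    (localRep e ω (e x)).compContinuousLinearMap (mfderiv (𝓡 M) (𝓡 M) e x) = ω x := by
  have hsymm := he.symm_comp_deriv hx
  have hpt : ∀ z, z = x → ∀ v : Fin h → E M, ω z v = ω x v := by
    rintro z rfl v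
    rfl
  ext v
  exact (hpt _ (e.left_inv hx) _).trans
    (congrArg (ω x) (funext fun i => DFunLike.congr_fun hsymm (v i)))

theorem localRep_coordChange (he : e.MDifferentiable (𝓡 M) (𝓡 M))
    (he' : e'.MDifferentiable (𝓡 M) (𝓡 M)) (ω : DForm M X h) {y : E M}
    (hy : y ∈ (e.symm.trans e').source) :
    localRep e ω y = (localRep e' ω (e.symm.trans e' y)).compContinuousLinearMap
      (fderiv ℝ (e.symm.trans e') y) := by
  rw [fderiv_coordChange he he' hy]
  ext v
  exact (DFunLike.congr_fun (localRep_comp_mfderiv he' ω hy.2)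
    fun i => mfderiv (𝓡 M) (𝓡 M) e.symm y (v i)).symm

theorem eq_zero_of_localRep_eq_zero (he : e.MDifferentiable (𝓡 M) (𝓡 M)) {ω : DForm M X h} {x : X}
    (hx : x ∈ e.source) (hω : localRep e ω (e x) = 0) : ω x = 0 := by
  rw [← localRep_comp_mfderiv he ω hx, hω]
  rfl

theorem localRep_dForm (hk : 2 ≤ k) [IsManifold (𝓡 M) k X] {ω : DForm M X h}
    (hω : IsFormOfClass k 1 ω) (he : e ∈ IsManifold.maximalAtlas (𝓡 M) k X) {y : E M}
    (hy : y ∈ e.target) :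
    localRep e (dForm ω) y = extDeriv (localRep e ω) y := by
  have hk₀ : k ≠ 0 := (two_pos.trans_le hk).ne'
  let c := chartAt (E M) (e.symm y)
  have hc : c ∈ IsManifold.maximalAtlas (𝓡 M) k X := IsManifold.chart_mem_maximalAtlas _
  have he_diff := mdifferentiable_of_mem_maximalAtlas hk₀ he
  have hc_diff := mdifferentiable_of_mem_maximalAtlas hk₀ hc
  have hyc : y ∈ (e.symm.trans c).source := ⟨hy, mem_chart_source _ _⟩
  have hdiff : DifferentiableAt ℝ (localRep c ω) (e.symm.trans c y) :=
    ((hω c hc).contDiffAt (c.open_target.mem_nhds (c.map_source hyc.2))).differentiableAt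
      one_ne_zero
  have hpullback : localRep e ω =ᶠ[𝓝 y] fun z =>
      (localRep c ω (e.symm.trans c z)).compContinuousLinearMap (fderiv ℝ (e.symm.trans c) z) := by
    filter_upwards [(e.symm.trans c).open_source.mem_nhds hyc] with z hz
    exact localRep_coordChange he_diff hc_diff ω hz
  rw [hpullback.extDeriv_eq, extDeriv_pullback hdiff (contDiffAt_coordChange he hc hyc)
    (by simpa using hk), fderiv_coordChange he_diff hc_diff hyc]
  rfl

theorem notMem_formSupport_iff {ω : DForm M X h} {x : X} :
    x ∉ formSupport ω ↔ ∀ᶠ z in 𝓝 x, ω z = 0 := by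
  simp [formSupport, mem_closure_iff_frequently]

theorem eq_zero_of_notMem_formSupport {ω : DForm M X h} {x : X} (hx : x ∉ formSupport ω) :
    ω x = 0 :=
  (notMem_formSupport_iff.1 hx).self_of_nhds

theorem formSupport_zero : formSupport (0 : DForm M X h) = ∅ := by
  simp [formSupport]

theorem formSupport_wedgeForm_subset_right {p q n : ℕ} (hn : p + q = n) (ω : DForm M X p)
    (η : DForm M X q) : formSupport (wedgeForm hn ω η) ⊆ formSupport η :=
  closure_mono fun x hx hη => hx (by rw [wedgeForm, hη]; exact wedge_zero_right hn _)

theorem dForm_eq_zero_of_notMem_formSupport {ω : DForm M X h} {x : X} (hx : x ∉ formSupport ω) :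
    dForm ω x = 0 := by
  let c := chartAt (E M) x
  have hxc : x ∈ c.source := mem_chart_source _ x
  have hlim : Tendsto c.symm (𝓝 (c x)) (𝓝 x) := c.tendsto_symm hxc
  have hlocal : localRep c ω =ᶠ[𝓝 (c x)] 0 := by
    filter_upwards [hlim.eventually (notMem_formSupport_iff.1 hx)] with y hy
    exact localRep_eq_zero hy
  rw [dForm, hlocal.extDeriv_eq, extDeriv_zero]
  rfl

theorem formSupport_dForm_subset (ω : DForm M X h) : formSupport (dForm ω) ⊆ formSupport ω :=
  closure_minimal (fun _ hx => not_imp_comm.1 dForm_eq_zero_of_notMem_formSupport hx)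
    isClosed_closure

theorem dForm_zero : dForm (0 : DForm M X h) = 0 :=
  funext fun _ => dForm_eq_zero_of_notMem_formSupport (by simp [formSupport_zero])

theorem wedgeForm_zero_right {p q n : ℕ} (hn : p + q = n) (ω : DForm M X p) :
    wedgeForm hn ω (0 : DForm M X q) = 0 :=
  funext fun _ => wedge_zero_right hn _

end Charts

section ChartForm

theorem isCompact_symm_image {Y Z : Type*} [TopologicalSpace Y] [TopologicalSpace Z]
    {e : OpenPartialHomeomorph Y Z} {K : Set Z} (hK : IsCompact K) (hKe : K ⊆ e.target) :
    IsCompact (e.symm '' K) :=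
  hK.image_of_continuousOn (e.continuousOn_symm.mono hKe)

variable {M : ℕ} {X : Type*} [TopologicalSpace X] [ChartedSpace (E M) X]
  {e : OpenPartialHomeomorph X (E M)} {p : ℕ} {η : E M → (E M) [⋀^Fin p]→L[ℝ] ℝ}

open Classical in
/-- The pullback by the chart `e` of a form `η` on `ℝ^M`, extended by zero outside the domain of
`e`. It turns test forms on the chart target into test forms on the manifold. -/
def chartForm (e : OpenPartialHomeomorph X (E M)) (η : E M → (E M) [⋀^Fin p]→L[ℝ] ℝ) :
    DForm M X p :=
  fun x => if x ∈ e.source then (η (e x)).compContinuousLinearMap (mfderiv (𝓡 M) (𝓡 M) e x) else 0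

theorem localRep_chartForm (he : e.MDifferentiable (𝓡 M) (𝓡 M)) {y : E M} (hy : y ∈ e.target) :
    localRep e (chartForm e η) y = η y := by
  have hcomp := he.comp_symm_deriv hy
  rw [localRep, chartForm, if_pos (e.map_target hy), e.right_inv hy]
  ext v
  exact congrArg (η y) (funext fun i => DFunLike.congr_fun hcomp (v i))

theorem chartForm_eq_zero_of_notMem {x : X} (hx : x ∉ e.symm '' tsupport η) :
    chartForm e η x = 0 := by
  rw [chartForm]
  split_ifs with hxe
  · rw [image_eq_zero_of_notMem_tsupport fun hη => hx ⟨e x, hη, e.left_inv hxe⟩]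
    rfl
  · rfl

variable [T2Space X]

theorem formSupport_chartForm_subset (hη : HasCompactSupport η) (hηe : tsupport η ⊆ e.target) :
    formSupport (chartForm e η) ⊆ e.symm '' tsupport η :=
  closure_minimal (fun _ hx => not_imp_comm.1 chartForm_eq_zero_of_notMem hx)
    (isCompact_symm_image hη hηe).isClosed

theorem isCompact_formSupport_chartForm (hη : HasCompactSupport η)
    (hηe : tsupport η ⊆ e.target) : IsCompact (formSupport (chartForm e η)) :=
  (isCompact_symm_image hη hηe).of_isClosed_subset isClosed_closure
    (formSupport_chartForm_subset hη hηe)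

theorem formSupport_chartForm_subset_source (hη : HasCompactSupport η)
    (hηe : tsupport η ⊆ e.target) : formSupport (chartForm e η) ⊆ e.source :=
  (formSupport_chartForm_subset hη hηe).trans
    (image_subset_iff.2 fun _ hy => e.map_target (hηe hy))

theorem isFormOfClass_chartForm (hη : HasCompactSupport η) (hηe : tsupport η ⊆ e.target)
    {k m : WithTop ℕ∞} (hm : m + 1 ≤ k)
    (he : e ∈ IsManifold.maximalAtlas (𝓡 M) k X) (hη_smooth : ContDiff ℝ m η) :
    IsFormOfClass k m (chartForm e η) := by
  have hk : k ≠ 0 := (zero_lt_one.trans_le (le_add_self.trans hm)).ne'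
  have he_diff := mdifferentiable_of_mem_maximalAtlas hk he
  intro e' he' y hy
  have he'_diff := mdifferentiable_of_mem_maximalAtlas hk he'
  refine ContDiffAt.contDiffWithinAt ?_
  by_cases hye : e'.symm y ∈ e.source
  · have hT := contDiffAt_coordChange he' he (y := y) ⟨hy, hye⟩
    have hlocal : localRep e' (chartForm e η) =ᶠ[𝓝 y] fun z =>
        (η (e'.symm.trans e z)).compContinuousLinearMap (fderiv ℝ (e'.symm.trans e) z) := by
      filter_upwards [(e'.symm.trans e).open_source.mem_nhds ⟨hy, hye⟩] with z hz
      rw [localRep_coordChange he'_diff he_diff _ hz,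
        localRep_chartForm he_diff ((e'.symm.trans e).map_source hz).1]
    exact (contDiff_compContinuousLinearMap.contDiffAt.comp y
      ((hη_smooth.contDiffAt.comp y (hT.of_le (le_self_add.trans hm))).prodMk
        (hT.fderiv_right hm))).congr_of_eventuallyEq hlocal
  · have hy_support : e'.symm y ∉ formSupport (chartForm e η) :=
      fun hmem => hye (formSupport_chartForm_subset_source hη hηe hmem)
    have hlocal : localRep e' (chartForm e η) =ᶠ[𝓝 y] 0 := by
      filter_upwards [(e'.continuousAt_symm hy).eventually
        (notMem_formSupport_iff.1 hy_support)] with z hz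
      exact localRep_eq_zero hz
    exact contDiffAt_const.congr_of_eventuallyEq hlocal

end ChartForm

/-! ### Integration in a chart -/

section Integral

/-- The standard basis of `ℝ^M` as a frame: the density `f` of an `M`-form `f dx_1 ∧ … ∧ dx_M` is
its value on this frame. -/
abbrev stdFrame (M : ℕ) : Fin M → E M := fun i => EuclideanSpace.single i 1

theorem coe_basisFun_toBasis (M : ℕ) :
    ⇑(EuclideanSpace.basisFun (Fin M) ℝ).toBasis = stdFrame M := by
  ext1 i
  simp

theorem compContinuousLinearMap_eq_det_smul {V : Type*} [NormedAddCommGroup V] [NormedSpace ℝ V]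
    {n : ℕ} (b : Module.Basis (Fin n) ℝ V) (c : V [⋀^Fin n]→L[ℝ] ℝ) (A : V →L[ℝ] V) :
    c.compContinuousLinearMap A = A.det • c := by
  have hc : ∀ v, c v = c b * b.det v := fun v =>
    DFunLike.congr_fun (c.toAlternatingMap.eq_smul_basis_det b) v
  ext v
  calc c (A ∘ v) = c b * b.det (A ∘ v) := hc _
    _ = c b * (A.det * b.det v) := congrArg (c b * ·) (b.det_comp A.toLinearMap v)
    _ = A.det • c v := by rw [hc v, smul_eq_mul, mul_left_comm]

theorem finsum_integral_partitionOfUnity_mul {ι X Y : Type*} [TopologicalSpace X]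
    [MeasurableSpace Y] {μ : Measure Y} (ρ : PartitionOfUnity ι X univ) {K : Set X}
    (hK : IsCompact K) {g : Y → X} {F : Y → ℝ} (hF : ∀ y, g y ∉ K → F y = 0)
    (hint : ∀ i, Integrable (fun y => ρ i (g y) * F y) μ) :
    ∑ᶠ i, ∫ y, ρ i (g y) * F y ∂μ = ∫ y, F y ∂μ := by
  have hfin : {i | (Function.support (ρ i) ∩ K).Nonempty}.Finite :=
    ρ.locallyFinite.finite_nonempty_inter_compact hK
  have hzero : ∀ i ∉ hfin.toFinset, ∀ y, ρ i (g y) * F y = 0 := by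
    intro i hi y
    by_cases hy : g y ∈ K
    · have hρ : ρ i (g y) = 0 := by
        by_contra hne
        exact hi (hfin.mem_toFinset.2 ⟨g y, hne, hy⟩)
      rw [hρ, zero_mul]
    · rw [hF y hy, mul_zero]
  have hsum : ∀ y, ∑ i ∈ hfin.toFinset, ρ i (g y) * F y = F y := by
    intro y
    rw [← finsum_eq_sum_of_support_subset _ (Function.support_subset_iff'.2 fun i hi =>
      hzero i (by simpa using hi) y), ← finsum_mul' _ _ (ρ.locallyFinite.point_finite (g y)),
      ρ.sum_eq_one (mem_univ _), one_mul]
  rw [finsum_eq_sum_of_support_subset (s := hfin.toFinset) _ (Function.support_subset_iff'.2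
    fun i hi => by simp only [hzero i (by simpa using hi), integral_zero]),
    ← integral_finsetSum _ fun i _ => hint i]
  simp only [hsum]

variable {M : ℕ} {k : WithTop ℕ∞} {X : Type*} [TopologicalSpace X] [ChartedSpace (E M) X]
  {e e₀ : OpenPartialHomeomorph X (E M)} {ω : DForm M X M}

theorem setIntegral_localRep_eq_setIntegral_coordChange_source (hω : ∀ x ∉ e₀.source, ω x = 0) :
    ∫ y in e.target, localRep e ω y (stdFrame M) =
      ∫ y in (e.symm.trans e₀).source, localRep e ω y (stdFrame M) := by
  refine setIntegral_eq_of_subset_of_forall_sdiff_eq_zero e.open_target.measurableSet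
    (fun y hy => hy.1) fun y hy => ?_
  rw [localRep_eq_zero (e := e) (hω _ fun he₀ => hy.2 ⟨hy.1, he₀⟩)]
  rfl

theorem ManifoldOrientation.setIntegral_localRep_eq (hk : k ≠ 0) (o : ManifoldOrientation M k X)
    (he : e ∈ o.charts) (he₀ : e₀ ∈ o.charts) (hω : ∀ x ∉ e.source ∩ e₀.source, ω x = 0) :
    ∫ y in e.target, localRep e ω y (stdFrame M) =
      ∫ y in e₀.target, localRep e₀ ω y (stdFrame M) := by
  have he_diff := mdifferentiable_of_mem_maximalAtlas hk (o.charts_subset he)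
  have he₀_diff := mdifferentiable_of_mem_maximalAtlas hk (o.charts_subset he₀)
  let T := e₀.symm.trans e
  have hT : ∀ y ∈ T.source, HasFDerivWithinAt T (fderiv ℝ T y) T.source y := fun y hy =>
    ((contDiffAt_coordChange (o.charts_subset he₀) (o.charts_subset he) hy).differentiableAt
      hk).hasFDerivAt.hasFDerivWithinAt
  calc ∫ y in e.target, localRep e ω y (stdFrame M)
      = ∫ y in T '' T.source, localRep e ω y (stdFrame M) := by
        rw [T.image_source_eq_target]
        exact setIntegral_localRep_eq_setIntegral_coordChange_source
          fun x hx => hω x fun hmem => hx hmem.2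
    _ = ∫ y in T.source, |(fderiv ℝ T y).det| • localRep e ω (T y) (stdFrame M) :=
        integral_image_eq_integral_abs_det_fderiv_smul volume T.open_source.measurableSet hT
          T.injOn _
    _ = ∫ y in T.source, localRep e₀ ω y (stdFrame M) := by
        refine setIntegral_congr_fun T.open_source.measurableSet fun y hy => ?_
        rw [localRep_coordChange he₀_diff he_diff ω hy, abs_of_pos (o.det_pos e₀ he₀ e he y hy),
          compContinuousLinearMap_eq_det_smul (EuclideanSpace.basisFun (Fin M) ℝ).toBasis]
        rfl
    _ = ∫ y in e₀.target, localRep e₀ ω y (stdFrame M) :=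
        (setIntegral_localRep_eq_setIntegral_coordChange_source
          fun x hx => hω x fun hmem => hx hmem.1).symm

variable [T2Space X] [ParacompactSpace X]

theorem ManifoldOrientation.partition_eq_zero (o : ManifoldOrientation M k X) (e : o.charts) {x : X}
    (hx : x ∉ e.1.source) : o.partition e x = 0 := by
  by_contra hne
  exact hx (o.exists_partitionOfUnity.choose_spec e (subset_tsupport _ hne))

theorem ManifoldOrientation.integral_eq_setIntegral_localRep (hk : k ≠ 0)
    (o : ManifoldOrientation M k X) (he₀ : e₀ ∈ o.charts) (hω : IsCompact (formSupport ω))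
    (hωe₀ : formSupport ω ⊆ e₀.source)
    (hcont : ContinuousOn (fun y => localRep e₀ ω y (stdFrame M)) e₀.target) :
    o.integral ω = ∫ y in e₀.target, localRep e₀ ω y (stdFrame M) := by
  have hzero : ∀ y, e₀.symm y ∉ formSupport ω → localRep e₀ ω y (stdFrame M) = 0 := by
    intro y hy
    rw [localRep_eq_zero (eq_zero_of_notMem_formSupport hy)]
    rfl
  have hterm : ∀ e : o.charts, (∫ y in e.1.target,
      o.partition e (e.1.symm y) * localRep e.1 ω y (stdFrame M)) =
      ∫ y in e₀.target, o.partition e (e₀.symm y) * localRep e₀ ω y (stdFrame M) := by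
    intro e
    refine o.setIntegral_localRep_eq (ω := fun x => o.partition e x • ω x) hk e.2 he₀ fun x hx => ?_
    by_cases hxe : x ∈ e.1.source
    · rw [eq_zero_of_notMem_formSupport fun hmem => hx ⟨hxe, hωe₀ hmem⟩]
      exact smul_zero _
    · rw [o.partition_eq_zero e hxe]
      exact zero_smul ℝ (ω x)
  have hint : ∀ e : o.charts, IntegrableOn
      (fun y => o.partition e (e₀.symm y) * localRep e₀ ω y (stdFrame M)) e₀.target := by
    intro e
    have hK : IsCompact (e₀ '' formSupport ω) := isCompact_symm_image (e := e₀.symm) hω hωe₀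
    have hKe₀ : e₀ '' formSupport ω ⊆ e₀.target :=
      image_subset_iff.2 fun x hx => e₀.map_source (hωe₀ hx)
    have hcont' : ContinuousOn
        (fun y => o.partition e (e₀.symm y) * localRep e₀ ω y (stdFrame M)) e₀.target :=
      ((o.partition e).continuous.comp_continuousOn e₀.continuousOn_symm).mul hcont
    refine ((hcont'.mono hKe₀).integrableOn_compact hK).of_forall_sdiff_eq_zero
      e₀.open_target.measurableSet fun y hy => ?_
    rw [hzero y fun hmem => hy.2 ⟨_, hmem, e₀.right_inv hy.1⟩, mul_zero]
  rw [ManifoldOrientation.integral, finsum_congr hterm]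
  exact finsum_integral_partitionOfUnity_mul o.partition hω hzero hint

end Integral

/-! ### Density points in charts -/

section Density

variable {V : Type*} [NormedAddCommGroup V] [NormedSpace ℝ V] [FiniteDimensional ℝ V]
  [MeasurableSpace V] [BorelSpace V] {μ : Measure V} [μ.IsAddHaarMeasure]

theorem exists_addHaar_image_le_of_hasStrictFDerivAt (μ : Measure V) [μ.IsAddHaarMeasure]
    {S : V → V} {S' : V →L[ℝ] V} {z : V} (hS : HasStrictFDerivAt S S' z) :
    ∃ C : NNReal, ∃ t ∈ 𝓝 z, ∀ s ⊆ t, μ (S '' s) ≤ C * μ s := by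
  obtain ⟨C, hC⟩ : ∃ C : NNReal, ENNReal.ofReal |S'.det| < C :=
    ENNReal.lt_iff_exists_nnreal_btwn.1 ENNReal.ofReal_lt_top |>.imp fun _ h => h.1
  obtain ⟨δ, himage, hδ⟩ :=
    ((addHaar_image_le_mul_of_det_lt μ S' hC).and self_mem_nhdsWithin).exists
  obtain ⟨t, ht, happrox⟩ := hS.approximates_deriv_on_nhds (Or.inr hδ)
  exact ⟨C, t, ht, fun s hst => himage s S (happrox.mono_set hst)⟩

theorem exists_measureReal_ball_sdiff_le {S T : V → V} {S' T' : V →L[ℝ] V} {y₀ : V}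
    (hT : HasStrictFDerivAt T T' y₀) (hS : HasStrictFDerivAt S S' (T y₀))
    (hST : ∀ᶠ y in 𝓝 y₀, S (T y) = y) {A B : Set V} (hAB : ∀ᶠ y in 𝓝 y₀, T y ∈ B → y ∈ A) :
    ∃ C κ : ℝ, 0 < κ ∧ ∀ᶠ r in 𝓝[>] (0 : ℝ),
      μ.real (Metric.ball y₀ r \ A) ≤ C * μ.real (Metric.ball (T y₀) (κ * r) \ B) := by
  obtain ⟨C, t, ht, himage⟩ := exists_addHaar_image_le_of_hasStrictFDerivAt μ hS
  obtain ⟨L, s, hs, hL⟩ := hT.exists_lipschitzOnWith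
  have hκ : (0 : ℝ) < L + 1 := by positivity
  refine ⟨C, L + 1, hκ, ?_⟩
  have hsmall_domain : ∀ᶠ r in 𝓝[>] (0 : ℝ),
      Metric.ball y₀ r ⊆ {y | y ∈ s ∧ S (T y) = y ∧ (T y ∈ B → y ∈ A)} :=
    nhdsWithin_le_nhds (eventually_ball_subset (inter_mem hs (hST.and hAB)))
  have hsmall_image : ∀ᶠ r in 𝓝[>] (0 : ℝ), Metric.ball (T y₀) ((L + 1) * r) ⊆ t :=
    eventually_nhdsGT_zero_mul_left hκ (nhdsWithin_le_nhds (eventually_ball_subset ht))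
  filter_upwards [hsmall_domain, hsmall_image, self_mem_nhdsWithin] with r hdomain himage_t hr
  have hsub : Metric.ball y₀ r \ A ⊆ S '' (Metric.ball (T y₀) ((L + 1) * r) \ B) := by
    rintro y ⟨hy, hyA⟩
    obtain ⟨hys, hSTy, hABy⟩ := hdomain hy
    refine ⟨T y, ⟨?_, mt hABy hyA⟩, hSTy⟩
    calc dist (T y) (T y₀) ≤ L * dist y y₀ := hL.dist_le_mul y hys _ (mem_of_mem_nhds hs)
      _ ≤ L * r := by gcongr; exact hy.le
      _ < (L + 1) * r := by linarith [mem_Ioi.1 hr]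
  have hfin : μ (Metric.ball (T y₀) ((L + 1) * r) \ B) ≠ ⊤ :=
    measure_ne_top_of_subset sdiff_subset measure_ball_lt_top.ne
  have hle := (measure_mono hsub).trans (himage _ (sdiff_subset.trans himage_t))
  simpa only [ENNReal.toReal_mul, ENNReal.coe_toReal, measureReal_def] using
    ENNReal.toReal_mono (ENNReal.mul_ne_top ENNReal.coe_ne_top hfin) hle

theorem isLittleO_rpow_comp_const_mul {f : ℝ → ℝ} {m κ : ℝ} (hκ : 0 < κ)
    (hf : f =o[𝓝[>] 0] fun r : ℝ => r ^ m) :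
    (fun r => f (κ * r)) =o[𝓝[>] 0] fun r : ℝ => r ^ m := by
  have hscale : Tendsto (κ * ·) (𝓝[>] 0) (𝓝[>] 0) :=
    tendsto_iff_comap.2 (comap_mulLeft_nhdsGT_zero hκ).ge
  refine (hf.comp_tendsto hscale).trans_isBigO (IsBigO.of_bound (κ ^ m) ?_)
  filter_upwards [self_mem_nhdsWithin] with r hr
  rw [Function.comp_apply, Real.mul_rpow hκ.le (mem_Ioi.1 hr).le, norm_mul,
    Real.norm_of_nonneg (Real.rpow_nonneg hκ.le _)]

theorem isLittleO_measureReal_ball_sdiff {S T : V → V} {S' T' : V →L[ℝ] V} {y₀ : V}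
    (hT : HasStrictFDerivAt T T' y₀) (hS : HasStrictFDerivAt S S' (T y₀))
    (hST : ∀ᶠ y in 𝓝 y₀, S (T y) = y) {A B : Set V} (hAB : ∀ᶠ y in 𝓝 y₀, T y ∈ B → y ∈ A) {m : ℝ}
    (h : (fun r => μ.real (Metric.ball (T y₀) r \ B)) =o[𝓝[>] 0] fun r : ℝ => r ^ m) :
    (fun r => μ.real (Metric.ball y₀ r \ A)) =o[𝓝[>] 0] fun r : ℝ => r ^ m := by
  obtain ⟨C, κ, hκ, hle⟩ := exists_measureReal_ball_sdiff_le (μ := μ) hT hS hST hAB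
  refine IsBigO.trans_isLittleO (IsBigO.of_bound C ?_) (isLittleO_rpow_comp_const_mul hκ h)
  filter_upwards [hle] with r hr
  rwa [Real.norm_of_nonneg measureReal_nonneg, Real.norm_of_nonneg measureReal_nonneg]

end Density

theorem IsDensityPoint.isLittleO {M : ℕ} {X : Type*} [TopologicalSpace X] [ChartedSpace (E M) X]
    {m : ℝ} {A : Set X} {Q : X} (hQ : IsDensityPoint (M := M) m A Q)
    {e₀ : OpenPartialHomeomorph X (E M)} (he₀ : e₀ ∈ IsManifold.maximalAtlas (𝓡 M) 1 X)
    (hQ₀ : Q ∈ e₀.source) :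
    (fun r : ℝ => volume.real (Metric.ball (e₀ Q) r \ e₀ '' (A ∩ e₀.source)))
      =o[𝓝[>] 0] fun r : ℝ => r ^ m := by
  obtain ⟨e, he, hQe, hlittle⟩ := hQ
  set T := e₀.symm.trans e with hT
  have hyT : e₀ Q ∈ T.source := by
    simpa [hT, e₀.map_source hQ₀, e₀.left_inv hQ₀] using hQe
  have hTy : T (e₀ Q) = e Q := by simp [hT, e₀.left_inv hQ₀]
  have hT_strict := (contDiffAt_coordChange he₀ he hyT).hasStrictFDerivAt one_ne_zero
  have hS_strict := (contDiffAt_coordChange he he₀ (y := T (e₀ Q))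
    (T.map_source hyT)).hasStrictFDerivAt one_ne_zero
  refine isLittleO_measureReal_ball_sdiff hT_strict hS_strict ?_
    (B := e '' (A ∩ e.source)) ?_ (by rwa [hTy])
  · exact T.eventually_left_inverse hyT
  · filter_upwards [T.open_source.mem_nhds hyT] with y hy
    rintro ⟨x, hx, hxy⟩
    have hx_eq : x = e₀.symm y := e.injOn hx.2 hy.2 hxy
    exact ⟨x, ⟨hx.1, hx_eq ▸ e₀.map_target hy.1⟩, hx_eq ▸ e₀.right_inv hy.1⟩

/-! ### Weak exterior derivatives on open subsets of a vector space -/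

section Weak

variable {V : Type*} [NormedAddCommGroup V] [NormedSpace ℝ V] {h p n : ℕ}

theorem inv_smul_sub_mem_ball_iff {r : ℝ} (hr : 0 < r) {y₀ y : V} :
    r⁻¹ • (y - y₀) ∈ Metric.ball 0 1 ↔ y ∈ Metric.ball y₀ r := by
  rw [mem_ball_zero_iff, norm_smul, norm_inv, Real.norm_of_nonneg hr.le, inv_mul_lt_iff₀ hr,
    mul_one, mem_ball_iff_norm]

theorem tsupport_comp_inv_smul_sub_subset {F : Type*} [Zero F] {η : V → F}
    (hη : tsupport η ⊆ Metric.ball 0 1) {r : ℝ} (hr : 0 < r) (y₀ : V) :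
    tsupport (fun y => η (r⁻¹ • (y - y₀))) ⊆ Metric.closedBall y₀ r :=
  closure_minimal (fun _ hy => Metric.ball_subset_closedBall <|
    (inv_smul_sub_mem_ball_iff hr).1 (hη (subset_tsupport η hy))) Metric.isClosed_closedBall

theorem exists_norm_wedge_apply_le {α β : Type*} [TopologicalSpace α] [TopologicalSpace β] {q : ℕ}
    (hn : p + q = n) (v : Fin n → V) {K : Set α} (hK : IsCompact K)
    {ω : α → V [⋀^Fin p]→L[ℝ] ℝ} (hω : ContinuousOn ω K) {K' : Set β} (hK' : IsCompact K')
    {η : β → V [⋀^Fin q]→L[ℝ] ℝ} (hη : ContinuousOn η K') :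
    ∃ C, ∀ y ∈ K, ∀ z ∈ K', ‖wedge hn (ω y) (η z) v‖ ≤ C := by
  obtain ⟨C, hC⟩ := (hK.prod hK').exists_bound_of_continuousOn <|
    (continuous_wedge_apply hn v).comp_continuousOn <|
      (hω.comp continuousOn_fst fun _ h => h.1).prodMk (hη.comp continuousOn_snd fun _ h => h.2)
  exact ⟨C, fun y hy z hz => hC (y, z) ⟨hy, hz⟩⟩

theorem norm_setIntegral_le_of_forall_notMem_eq_zero {α F : Type*} [MeasurableSpace α]
    [NormedAddCommGroup F] [NormedSpace ℝ F] {μ : Measure α} {f : α → F} {s U : Set α}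
    (hsU : s ⊆ U) (hs : μ s < ⊤) {C : ℝ} (hf : ∀ y ∈ s, ‖f y‖ ≤ C) (hf₀ : ∀ y ∉ s, f y = 0) :
    ‖∫ y in U, f y ∂μ‖ ≤ C * μ.real s := by
  rw [setIntegral_eq_integral_of_forall_compl_eq_zero fun y hy => hf₀ y (mt (@hsU y) hy),
    ← setIntegral_eq_integral_of_forall_compl_eq_zero hf₀]
  exact norm_setIntegral_le_of_norm_le_const hs hf

variable [FiniteDimensional ℝ V] [MeasurableSpace V]

/-- `δ` is the weak exterior derivative of `γ` on the open set `U`. Top-degree forms are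
integrated against `μ` after evaluation on the basis `b`. -/
def HasWeakExtDerivOn (μ : Measure V) (b : Module.Basis (Fin n) ℝ V)
    (γ : V → V [⋀^Fin h]→L[ℝ] ℝ) (δ : V → V [⋀^Fin (h + 1)]→L[ℝ] ℝ) (U : Set V) : Prop :=
  ∀ (p : ℕ) (hp : h + 1 + p = n) (η : V → V [⋀^Fin p]→L[ℝ] ℝ), ContDiff ℝ (⊤ : ℕ∞) η →
    HasCompactSupport η → tsupport η ⊆ U →
    ∫ y in U, wedge (show h + (p + 1) = n by omega) (γ y) (extDeriv η y) b ∂μ =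
      (-1) ^ (h + 1) * ∫ y in U, wedge hp (δ y) (η y) b ∂μ

variable {μ : Measure V} [μ.IsAddHaarMeasure] {U : Set V} {y₀ : V}

theorem isBigO_setIntegral_wedge_extDeriv (hn : h + (p + 1) = n) (v : Fin n → V)
    (hU : U ∈ 𝓝 y₀) {γ : V → V [⋀^Fin h]→L[ℝ] ℝ} (hγ : ContinuousOn γ U)
    {η : V → V [⋀^Fin p]→L[ℝ] ℝ} (hη : ContDiff ℝ 1 η) (hη_supp : tsupport η ⊆ Metric.ball 0 1)
    {Z : Set V} (hZ : ∀ y ∈ Z, γ y = 0) :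
    (fun r : ℝ => ∫ y in U, wedge hn (γ y) (extDeriv (fun z => η (r⁻¹ • (z - y₀))) y) v ∂μ)
      =O[𝓝[>] 0] fun r => r⁻¹ * μ.real (Metric.ball y₀ r \ Z) := by
  obtain ⟨R, hR, hRU⟩ := Metric.nhds_basis_closedBall.mem_iff.1 hU
  obtain ⟨C, hC⟩ := exists_norm_wedge_apply_le hn v (isCompact_closedBall y₀ R) (hγ.mono hRU)
    (isCompact_closedBall (0 : V) 1) (continuous_extDeriv hη).continuousOn
  refine IsBigO.of_bound C ?_
  filter_upwards [Ioo_mem_nhdsGT hR] with r ⟨hr, hrR⟩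
  have hsub : Metric.ball y₀ r \ Z ⊆ Metric.closedBall y₀ R :=
    sdiff_subset.trans (Metric.ball_subset_closedBall.trans
      (Metric.closedBall_subset_closedBall hrR.le))
  simp only [extDeriv_comp_smul_sub, wedge_smul_right, ContinuousAlternatingMap.smul_apply]
  rw [norm_mul, norm_inv, Real.norm_of_nonneg hr.le, Real.norm_of_nonneg measureReal_nonneg,
    ← mul_assoc]
  refine norm_setIntegral_le_of_forall_notMem_eq_zero (hsub.trans hRU)
    (measure_lt_top_of_subset sdiff_subset measure_ball_lt_top.ne) (fun y hy => ?_) fun y hy => ?_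
  · rw [norm_smul, norm_inv, Real.norm_of_nonneg hr.le, mul_comm]
    gcongr
    exact hC y (hsub hy) _
      (Metric.ball_subset_closedBall ((inv_smul_sub_mem_ball_iff hr).2 hy.1))
  · by_cases hyr : y ∈ Metric.ball y₀ r
    · rw [hZ y (by_contra fun hyZ => hy ⟨hyr, hyZ⟩), wedge_zero_left]
      exact smul_zero _
    · have hzero : extDeriv η (r⁻¹ • (y - y₀)) = 0 := by
        refine Function.notMem_support.1 fun hsupp => hyr ?_
        exact (inv_smul_sub_mem_ball_iff hr).1 (hη_supp (support_extDeriv_subset η hsupp))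
      rw [hzero, wedge_zero_right]
      exact smul_zero _

theorem HasWeakExtDerivOn.isLittleO_setIntegral {b : Module.Basis (Fin n) ℝ V}
    {γ : V → V [⋀^Fin h]→L[ℝ] ℝ} {δ : V → V [⋀^Fin (h + 1)]→L[ℝ] ℝ}
    (hγδ : HasWeakExtDerivOn μ b γ δ U) (hn : h + 1 + p = n) (hU : U ∈ 𝓝 y₀)
    (hγ : ContinuousOn γ U) {η : V → V [⋀^Fin p]→L[ℝ] ℝ} (hη : ContDiff ℝ (⊤ : ℕ∞) η)
    (hη_supp : tsupport η ⊆ Metric.ball 0 1) {Z : Set V} (hZ : ∀ y ∈ Z, γ y = 0)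
    (hdens : (fun r => μ.real (Metric.ball y₀ r \ Z)) =o[𝓝[>] 0] fun r : ℝ => r ^ (n + 1)) :
    (fun r : ℝ => ∫ y in U, wedge hn (δ y) (η (r⁻¹ • (y - y₀))) b ∂μ)
      =o[𝓝[>] 0] fun r => r ^ n := by
  have hn' : h + (p + 1) = n := by omega
  have hweak : ∀ᶠ r in 𝓝[>] (0 : ℝ),
      (-1) ^ (h + 1) * ∫ y in U, wedge hn' (γ y) (extDeriv (fun z => η (r⁻¹ • (z - y₀))) y) b ∂μ =
        ∫ y in U, wedge hn (δ y) (η (r⁻¹ • (y - y₀))) b ∂μ := by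
    filter_upwards [nhdsWithin_le_nhds (eventually_closedBall_subset hU), self_mem_nhdsWithin]
      with r hrU hr
    have hsupp := tsupport_comp_inv_smul_sub_subset hη_supp hr y₀
    rw [hγδ p hn (fun y => η (r⁻¹ • (y - y₀))) (hη.comp (by fun_prop))
      ((isCompact_closedBall y₀ r).of_isClosed_subset (isClosed_tsupport _) hsupp)
      (hsupp.trans hrU), ← mul_assoc, ← mul_pow, neg_one_mul, neg_neg, one_pow, one_mul]
  have hupper := isBigO_setIntegral_wedge_extDeriv (μ := μ) hn' b hU hγ
    (hη.of_le (by simp)) hη_supp hZ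
  have hsmall : (fun r => r⁻¹ * μ.real (Metric.ball y₀ r \ Z)) =o[𝓝[>] 0] fun r : ℝ => r ^ n := by
    refine ((isBigO_refl _ _).mul_isLittleO hdens).congr' EventuallyEq.rfl ?_
    filter_upwards [self_mem_nhdsWithin] with r hr
    rw [pow_succ', inv_mul_cancel_left₀ (ne_of_gt hr)]
  exact ((hupper.trans_isLittleO hsmall).const_mul_left _).congr' hweak EventuallyEq.rfl

variable [BorelSpace V]

theorem tendsto_integral_peak {φ : V → ℝ} (hφ : ∀ z, 0 ≤ φ z) (hφ_int : ∫ z, φ z ∂μ = 1)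
    (hφ_supp : tsupport φ ⊆ Metric.ball 0 1) {g : V → ℝ} (hg : Integrable g μ)
    (hg_cont : ContinuousAt g y₀) :
    Tendsto (fun r : ℝ => (∫ y, φ (r⁻¹ • (y - y₀)) * g y ∂μ) / r ^ Module.finrank ℝ V)
      (𝓝[>] 0) (𝓝 (g y₀)) := by
  have hdecay : Tendsto (fun z => ‖z‖ ^ Module.finrank ℝ V * φ (-z))
      (Bornology.cobounded V) (𝓝 0) := by
    refine tendsto_const_nhds.congr' ?_
    filter_upwards [Bornology.isBounded_def.1 (Metric.isBounded_ball (x := (0 : V)) (r := 1))]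
      with z hz
    have hφz : φ (-z) = 0 := Function.notMem_support.1 fun hsupp => hz <| by
      simpa using hφ_supp (subset_tsupport φ hsupp)
    rw [hφz, mul_zero]
  have hpeak := (tendsto_integral_comp_smul_smul_of_integrable' (φ := fun z => φ (-z))
    (fun z => hφ (-z)) (by rwa [integral_neg_eq_self]) hdecay hg hg_cont).comp
    tendsto_inv_nhdsGT_zero
  refine hpeak.congr fun r => ?_
  simp only [Function.comp_apply, ← smul_neg, neg_sub, inv_pow, smul_eq_mul, mul_assoc,
    integral_const_mul, div_eq_inv_mul]

theorem tendsto_setIntegral_peak {φ : V → ℝ} (hφ : ∀ z, 0 ≤ φ z) (hφ_int : ∫ z, φ z ∂μ = 1)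
    (hφ_supp : tsupport φ ⊆ Metric.ball 0 1) (hU : U ∈ 𝓝 y₀) {g : V → ℝ} (hg : ContinuousOn g U) :
    Tendsto (fun r : ℝ => (∫ y in U, φ (r⁻¹ • (y - y₀)) * g y ∂μ) / r ^ Module.finrank ℝ V)
      (𝓝[>] 0) (𝓝 (g y₀)) := by
  obtain ⟨R, hR, hRU⟩ := Metric.nhds_basis_closedBall.mem_iff.1 hU
  set K := Metric.closedBall y₀ R
  have hK : K ∈ 𝓝 y₀ := Metric.closedBall_mem_nhds y₀ hR
  have hint : Integrable (K.indicator g) μ :=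
    ((hg.mono hRU).integrableOn_compact (isCompact_closedBall y₀ R)).integrable_indicator
      Metric.isClosed_closedBall.measurableSet
  have hcont : ContinuousAt (K.indicator g) y₀ :=
    (hg.continuousAt hU).congr <| Filter.mem_of_superset hK fun y hy =>
      (indicator_of_mem hy g).symm
  have hpeak := tendsto_integral_peak hφ hφ_int hφ_supp hint hcont
  rw [indicator_of_mem (mem_of_mem_nhds hK)] at hpeak
  refine hpeak.congr' ?_
  filter_upwards [Ioo_mem_nhdsGT hR] with r ⟨hr, hrR⟩
  have hφ_zero : ∀ y ∉ K, φ (r⁻¹ • (y - y₀)) = 0 := fun y hy =>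
    Function.notMem_support.1 fun hsupp => hy <| Metric.ball_subset_closedBall <|
      Metric.ball_subset_ball hrR.le <|
        (inv_smul_sub_mem_ball_iff hr).1 (hφ_supp (subset_tsupport φ hsupp))
  rw [setIntegral_eq_integral_of_forall_compl_eq_zero]
  · congr 2 with y
    by_cases hy : y ∈ K
    · rw [indicator_of_mem hy]
    · rw [hφ_zero y hy, zero_mul, zero_mul]
  · intro y hy
    rw [hφ_zero y (mt (@hRU y) hy), zero_mul]

theorem HasWeakExtDerivOn.eq_zero {b : Module.Basis (Fin n) ℝ V} {γ : V → V [⋀^Fin h]→L[ℝ] ℝ}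
    {δ : V → V [⋀^Fin (h + 1)]→L[ℝ] ℝ} (hγδ : HasWeakExtDerivOn μ b γ δ U) (hn : h + 1 ≤ n)
    (hU : U ∈ 𝓝 y₀) (hγ : ContinuousOn γ U) (hδ : ContinuousOn δ U) {Z : Set V}
    (hZ : ∀ y ∈ Z, γ y = 0)
    (hdens : (fun r => μ.real (Metric.ball y₀ r \ Z)) =o[𝓝[>] 0] fun r : ℝ => r ^ (n + 1)) :
    δ y₀ = 0 := by
  obtain ⟨p, hp⟩ := Nat.exists_eq_add_of_le hn
  refine eq_zero_of_forall_wedge_eq_zero hp.symm b _ fun c => ?_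
  let φ : ContDiffBump (0 : V) := ⟨1 / 4, 1 / 2, by norm_num, by norm_num⟩
  have hφ_supp : tsupport (φ.normed μ) ⊆ Metric.ball 0 1 := by
    rw [φ.tsupport_normed_eq]
    exact Metric.closedBall_subset_ball (by norm_num [φ])
  have hlittle := hγδ.isLittleO_setIntegral hp.symm hU hγ (η := fun z => φ.normed μ z • c)
    (φ.contDiff_normed.smul contDiff_const) ((tsupport_smul_subset_left _ _).trans hφ_supp)
    hZ hdens
  have hlimit := tendsto_setIntegral_peak (μ := μ) φ.nonneg_normed φ.integral_normed hφ_supp hU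
    ((continuous_wedge_apply hp.symm b).comp_continuousOn (hδ.prodMk (continuousOn_const (c := c))))
  rw [Module.finrank_eq_card_basis b, Fintype.card_fin] at hlimit
  refine tendsto_nhds_unique hlimit (hlittle.tendsto_div_nhds_zero.congr fun r => ?_)
  simp only [wedge_smul_right]
  rfl

end Weak

/-! ### Localization of the distributional exterior derivative -/

section Localization

variable {M L h p q n : ℕ} {X : Type*} [TopologicalSpace X] [ChartedSpace (E M) X]

theorem MatForm.isOfClass_single {k m : WithTop ℕ∞} {φ : DForm M X p} (hφ : IsFormOfClass k m φ)
    (s t : Fin L) : MatForm.IsOfClass k m (Matrix.single s t φ) := by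
  intro i j
  rw [Matrix.single_apply]
  split_ifs
  · exact hφ
  · exact fun _ _ => contDiffOn_const (c := 0)

theorem MatForm.hasCompactSupp_single {φ : DForm M X p} (hφ : IsCompact (formSupport φ))
    (s t : Fin L) : MatForm.HasCompactSupp (Matrix.single s t φ) := by
  intro i j
  rw [Matrix.single_apply]
  split_ifs
  · exact hφ
  · rw [formSupport_zero]
    exact isCompact_empty

theorem MatForm.d_single (s t : Fin L) (φ : DForm M X p) :
    MatForm.d (Matrix.single s t φ) = Matrix.single s t (dForm φ) := by
  ext i j : 2
  rw [MatForm.d, Matrix.of_apply, Matrix.single_apply, Matrix.single_apply, apply_ite dForm,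
    dForm_zero]

theorem MatForm.wedge_single_apply (hn : p + q = n) (ω : MatForm M X L p) (i s t : Fin L)
    (φ : DForm M X q) :
    MatForm.wedge hn ω (Matrix.single s t φ) i t = wedgeForm hn (ω i s) φ := by
  rw [MatForm.wedge, Matrix.of_apply, Finset.sum_eq_single_of_mem s (Finset.mem_univ s),
    Matrix.single_apply_same]
  intro s' _ hs'
  rw [Matrix.single_apply_of_row_ne hs'.symm, wedgeForm_zero_right]

variable [T2Space X] [ParacompactSpace X] {e : OpenPartialHomeomorph X (E M)}

theorem ManifoldOrientation.integral_wedgeForm_eq_setIntegral {k : WithTop ℕ∞} (hk : k ≠ 0)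
    (o : ManifoldOrientation M k X) (he : e ∈ o.charts) (hn : p + q = M) {ω : DForm M X p}
    (hω : ContinuousOn (localRep e ω) e.target) {φ : DForm M X q}
    (hφ : IsCompact (formSupport φ)) (hφe : formSupport φ ⊆ e.source)
    {η : E M → (E M) [⋀^Fin q]→L[ℝ] ℝ} (hη : Continuous η)
    (hφη : EqOn (localRep e φ) η e.target) :
    o.integral (wedgeForm hn ω φ) =
      ∫ y in e.target, wedge hn (localRep e ω y) (η y) (stdFrame M) := by
  have hsupp := formSupport_wedgeForm_subset_right hn ω φ
  have hloc : EqOn (fun y => localRep e (wedgeForm hn ω φ) y (stdFrame M))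
      (fun y => wedge hn (localRep e ω y) (η y) (stdFrame M)) e.target := fun y hy => by
    simp only [localRep_wedgeForm, hφη hy]
  have hcont := ((continuous_wedge_apply hn (stdFrame M)).comp_continuousOn
    (hω.prodMk hη.continuousOn)).congr hloc
  rw [o.integral_eq_setIntegral_localRep hk he (hφ.of_isClosed_subset isClosed_closure hsupp)
    (hsupp.trans hφe) hcont, setIntegral_congr_fun e.open_target.measurableSet hloc]

theorem IsDED.integral_wedgeForm_eq {k : ℕ∞} {o : ManifoldOrientation M k X} {γ : MatForm M X L h}
    {δγ : MatForm M X L (h + 1)} (hδγ : IsDED o γ δγ) (hp : h + 1 + p = M) {φ : DForm M X p}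
    (hφ : IsFormOfClass k ((k - 1 : ℕ∞) : WithTop ℕ∞) φ) (hφ_supp : IsCompact (formSupport φ))
    (i s : Fin L) :
    o.integral (wedgeForm (show h + (p + 1) = M by omega) (γ i s) (dForm φ)) =
      (-1) ^ (h + 1) * o.integral (wedgeForm hp (δγ i s) φ) := by
  have htest := congrFun₂ (hδγ.2 p hp (Matrix.single s s φ) (MatForm.isOfClass_single hφ s s)
    (MatForm.hasCompactSupp_single hφ_supp s s)) i s
  simpa only [MatForm.d_single, ManifoldOrientation.matIntegral, Matrix.smul_apply,
    Matrix.of_apply, MatForm.wedge_single_apply, smul_eq_mul] using htest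

theorem IsDED.hasWeakExtDerivOn {k : ℕ∞} (hk : 2 ≤ k) [IsManifold (𝓡 M) k X]
    {o : ManifoldOrientation M k X} {γ : MatForm M X L h} (hγ : γ.IsOfClass k 0)
    {δγ : MatForm M X L (h + 1)} (hδγ : IsDED o γ δγ) (he : e ∈ o.charts) (i s : Fin L) :
    HasWeakExtDerivOn volume (EuclideanSpace.basisFun (Fin M) ℝ).toBasis
      (localRep e (γ i s)) (localRep e (δγ i s)) e.target := by
  intro p hp η hη hη_supp hηe
  have hk₂ : (2 : WithTop ℕ∞) ≤ k := WithTop.coe_le_coe.2 hk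
  have hk₀ : (k : WithTop ℕ∞) ≠ 0 := (two_pos.trans_le hk₂).ne'
  have hk_sub : ((k - 1 : ℕ∞) : WithTop ℕ∞) + 1 ≤ k := by
    exact_mod_cast (tsub_add_cancel_of_le (one_le_two.trans hk)).le
  have hk_one : (1 : WithTop ℕ∞) + 1 ≤ k := by rwa [one_add_one_eq_two]
  have he_atlas := o.charts_subset he
  have hη_one : ContDiff ℝ 1 η := hη.of_le (by simp)
  have hclass : IsFormOfClass k ((k - 1 : ℕ∞) : WithTop ℕ∞) (chartForm e η) :=
    isFormOfClass_chartForm hη_supp hηe hk_sub he_atlas (hη.of_le (by simp))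
  have hlocal : EqOn (localRep e (chartForm e η)) η e.target := fun y hy =>
    localRep_chartForm (mdifferentiable_of_mem_maximalAtlas hk₀ he_atlas) hy
  have hlocal_d : EqOn (localRep e (dForm (chartForm e η))) (extDeriv η) e.target := fun y hy => by
    rw [localRep_dForm hk₂ (isFormOfClass_chartForm hη_supp hηe hk_one he_atlas hη_one)
      he_atlas hy, (hlocal.eventuallyEq_of_mem (e.open_target.mem_nhds hy)).extDeriv_eq]
  have hsupp := isCompact_formSupport_chartForm hη_supp hηe
  have hsupp_source := formSupport_chartForm_subset_source hη_supp hηe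
  have hsupp_d := formSupport_dForm_subset (chartForm e η)
  have hidentity := hδγ.integral_wedgeForm_eq hp hclass hsupp i s
  rwa [o.integral_wedgeForm_eq_setIntegral hk₀ he _ (hγ i s e he_atlas).continuousOn
      (hsupp.of_isClosed_subset isClosed_closure hsupp_d) (hsupp_d.trans hsupp_source)
      (continuous_extDeriv hη_one) hlocal_d,
    o.integral_wedgeForm_eq_setIntegral hk₀ he _ (hδγ.1 i s e he_atlas).continuousOn
      hsupp hsupp_source hη.continuous hlocal, ← coe_basisFun_toBasis] at hidentity

end Localization

end SuperdensityForms

end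

open SuperdensityForms in
theorem theorem3p1 {M L h : ℕ} (hh : h + 1 ≤ M) {k : ℕ∞} (hk : 2 ≤ k)
    {X : Type*} [TopologicalSpace X] [T2Space X] [ParacompactSpace X]
    [ChartedSpace (EuclideanSpace ℝ (Fin M)) X] [IsManifold (𝓡 M) k X]
    (o : ManifoldOrientation M k X)
    (γ : MatForm M X L h) (hγ : γ.IsOfClass k 0)
    (δγ : MatForm M X L (h + 1)) (hδγ : IsDED o γ δγ)
    (Q : X) (hQ : IsDensityPoint (M := M) ((M : ℝ) + 1) γ.zeroSet Q) :
    δγ.eval Q = 0 := by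
  have hk₁ : (1 : WithTop ℕ∞) ≤ k := by exact_mod_cast one_le_two.trans hk
  obtain ⟨e, he, hQe⟩ := o.cover Q
  have he_atlas := o.charts_subset he
  have he_C1 := IsManifold.maximalAtlas_subset_of_le hk₁ he_atlas
  have hdens := hQ.isLittleO he_C1 hQe
  simp only [← Nat.cast_succ, Real.rpow_natCast] at hdens
  refine Matrix.ext fun i s => eq_zero_of_localRep_eq_zero
    (mdifferentiable_of_mem_maximalAtlas one_ne_zero he_C1) hQe ?_
  refine (hδγ.hasWeakExtDerivOn hk hγ he i s).eq_zero hh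
    (e.open_target.mem_nhds (e.map_source hQe)) (hγ i s e he_atlas).continuousOn
    (hδγ.1 i s e he_atlas).continuousOn ?_ hdens
  rintro _ ⟨x, ⟨hx, hxe⟩, rfl⟩
  refine localRep_eq_zero ?_
  rw [e.left_inv hxe]
  exact congrFun₂ hx i s
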